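/- Let $(S_u)_{u\ge 0}$ be a Brownian motion started at $0$, without drift and with an arbitrary variance parameter $\sigma^2>0$ (so that $S_0=0$ almost surely, the paths are almost surely continuous, the increments are independent, and $S_v-S_u\sim N(0,\sigma^2(v-u))$ for $u\le v$; standard Brownian motion is the case $\sigma=1$). For $\tau\ge 0$ let $T_\tau=\inf\{u\ge 0: S_u\ge\tau\}\in[0,\infty]$, where $\inf\emptyset=\infty$. Let $t>0$. Then for every $\theta<\tau$ $$P(T_\tau<t\mid S_t=\theta)=\exp\left\{-\frac{2\tau(\tau-\theta)}{\operatorname{var}(S_t)}\right\},$$ where the conditional probability given the null event $\{S_t=\theta\}$ is understood as the infinitesimal limit $$P(T_\tau<t\mid S_t=\theta)=\lim_{h\downarrow 0}P\big(T_\tau<t\mid S_t\in[\theta,\theta+h)\big);$$ in particular, this limit exists. Moreover, the same formula holds for the regular conditional distribution of $T_\tau$ given $S_t$: for Lebesgue-almost every $\theta<\tau$, the mass that this conditional distribution at $S_t=\theta$ gives to $[0,t)$ is $\exp\{-2\tau(\tau-\theta)/\operatorname{var}(S_t)\}$. -/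

import Mathlib

open MeasureTheory ProbabilityTheory Filter Topology
open scoped NNReal ENNReal

/-- A (driftless) Brownian motion started at `0`, with an arbitrary variance parameter `σ ^ 2 > 0`:
the process `S / σ` is a standard Brownian motion, that is, it has the finite-dimensional laws of
standard Brownian motion and almost surely continuous paths. Standard Brownian motion is the case
`σ = 1`. -/
def IsBrownianMotion {Ω : Type*} [MeasurableSpace Ω] (S : ℝ≥0 → Ω → ℝ) (P : Measure Ω) : Prop :=
  ∃ σ : ℝ, 0 < σ ∧ IsBrownianReal (fun u ω ↦ S u ω / σ) P

/-- The first crossing time `T_τ = inf {u ≥ 0 : S_u ≥ τ}`, with values in `[0, ∞]`; it is `∞` on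
paths that never reach the level `τ`. -/
noncomputable def crossingTime {Ω : Type*} (S : ℝ≥0 → Ω → ℝ) (τ : ℝ) (ω : Ω) : ℝ≥0∞ :=
  ⨅ (u : ℝ≥0) (_ : τ ≤ S u ω), (u : ℝ≥0∞)

/-! Reflecting a path at the level τ from its first crossing on preserves its law. A path ending
above τ must have crossed, so for A below τ the event "crossed before t, ends in A" has probability
P(2τ - S_t ∈ A). Below τ, the joint law of crossing and endpoint is therefore N(2τ, v), while S_t
itself has law N(0, v); the ratio of these Gaussian densities is the exponential. Averaging it over
[θ, θ + h), or disintegrating, gives the two claims.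

No strong Markov property is used. On a finite grid the first exceedance takes finitely many values,
and independence and symmetry of increments give an exact identity
(`lintegral_firstExceedsValue_reflect`). As the grid is refined the overshoot vanishes, which gives
`lintegral_reflect`. This concerns strict exceedance; `setOf_exceedsOnGrid_ae_eq` passes to the
crossing time. -/

/-- The sequence `x` exceeds the level `a` for the first time at the index `k`. -/
def FirstExceeds (a : ℝ) (x : ℕ → ℝ) (k : ℕ) : Prop := a < x k ∧ ∀ j < k, x j ≤ a

lemma exists_firstExceeds {a : ℝ} {x : ℕ → ℝ} {m : ℕ} (h : ∃ j ≤ m, a < x j) :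
    ∃ k ≤ m, FirstExceeds a x k := by
  classical
  obtain ⟨j, hjm, hj⟩ := h
  have hex : ∃ j, a < x j := ⟨j, hj⟩
  exact ⟨Nat.find hex, (Nat.find_min' hex hj).trans hjm, Nat.find_spec hex,
    fun i hi ↦ not_lt.1 (Nat.find_min hex hi)⟩

lemma FirstExceeds.unique {a : ℝ} {x : ℕ → ℝ} {k l : ℕ} (hk : FirstExceeds a x k)
    (hl : FirstExceeds a x l) : l = k := by
  rcases lt_trichotomy l k with h | h | h
  · exact absurd hl.1 (not_lt.2 (hk.2 l h))
  · exact h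
  · exact absurd hk.1 (not_lt.2 (hl.2 k h))

open Classical in
/-- The value of `g` at the first index `k ≤ m` at which `x` exceeds `a`, and `0` if there is no
such index. -/
noncomputable def firstExceedsValue (a : ℝ) (x : ℕ → ℝ) (m : ℕ) (g : ℕ → ℝ≥0∞) : ℝ≥0∞ :=
  ∑ k ∈ Finset.range (m + 1), if FirstExceeds a x k then g k else 0

lemma FirstExceeds.value_eq {a : ℝ} {x : ℕ → ℝ} {k m : ℕ} (hk : FirstExceeds a x k) (hkm : k ≤ m)
    (g : ℕ → ℝ≥0∞) : firstExceedsValue a x m g = g k := by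
  rw [firstExceedsValue, Finset.sum_eq_single k]
  · simp [hk]
  · intro l _ hl
    rw [if_neg fun h ↦ hl (hk.unique h)]
  · intro h
    exact absurd (Finset.mem_range.2 (Nat.lt_succ_of_le hkm)) h

lemma firstExceedsValue_eq_zero {a : ℝ} {x : ℕ → ℝ} {m : ℕ} (h : ∀ j ≤ m, x j ≤ a)
    (g : ℕ → ℝ≥0∞) : firstExceedsValue a x m g = 0 := by
  refine Finset.sum_eq_zero fun k hk ↦ if_neg fun hx ↦ ?_
  exact absurd hx.1 (not_lt.2 (h k (Nat.lt_succ_iff.1 (Finset.mem_range.1 hk))))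

lemma firstExceedsValue_le {a : ℝ} {x : ℕ → ℝ} {m : ℕ} {g : ℕ → ℝ≥0∞} {C : ℝ≥0∞}
    (hg : ∀ k, g k ≤ C) : firstExceedsValue a x m g ≤ C := by
  by_cases h : ∃ j ≤ m, a < x j
  · obtain ⟨k, hkm, hk⟩ := exists_firstExceeds h
    rw [hk.value_eq hkm]
    exact hg k
  · push Not at h
    rw [firstExceedsValue_eq_zero h]
    exact zero_le

/-! ### Reflection at a deterministic grid time -/

section Discrete

variable {Ω : Type*} [MeasurableSpace Ω] {P : Measure Ω} {B : ℝ≥0 → Ω → ℝ}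

lemma measurableSet_firstExceeds {β : Type*} [MeasurableSpace β] (a : ℝ) {x : β → ℕ → ℝ} {k : ℕ}
    (hx : ∀ j ≤ k, Measurable fun b ↦ x b j) : MeasurableSet {b | FirstExceeds a (x b) k} := by
  have : {b | FirstExceeds a (x b) k} =
      {b | a < x b k} ∩ ⋂ j ∈ Finset.range k, {b | x b j ≤ a} := by
    ext b; simp [FirstExceeds]
  rw [this]
  refine (measurableSet_lt measurable_const (hx k le_rfl)).inter
    (Finset.measurableSet_biInter _ fun j hj ↦ ?_)
  exact measurableSet_le (hx j (Finset.mem_range.1 hj).le) measurable_const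

lemma ProbabilityTheory.IsPreBrownianReal.nullMeasurableSet_firstExceeds
    (hB : IsPreBrownianReal B P) (a : ℝ) (s : ℕ → ℝ≥0) (k : ℕ) :
    NullMeasurableSet {ω | FirstExceeds a (fun j ↦ B (s j) ω) k} P := by
  have : {ω | FirstExceeds a (fun j ↦ B (s j) ω) k} =
    {ω | a < B (s k) ω} ∩ ⋂ j ∈ Finset.range k, {ω | B (s j) ω ≤ a} := by
    ext b; simp [FirstExceeds]
  rw [this]
  refine (nullMeasurableSet_lt aemeasurable_const (hB.aemeasurable _)).inter
    (Finset.nullMeasurableSet_biInter _ fun j _ ↦ ?_)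
  exact nullMeasurableSet_le (hB.aemeasurable _) aemeasurable_const

/-- Replacing the increment after time `s k` by its negative preserves the joint law of that
increment and the path before `s k`. -/
lemma ProbabilityTheory.IsPreBrownianReal.lintegral_reflect_of_firstExceeds
    (hB : IsPreBrownianReal B P) (a : ℝ) {s : ℕ → ℝ≥0} (hs : Monotone s) {k : ℕ} {t : ℝ≥0}
    (hk : s k ≤ t) {f : ℝ → ℝ≥0∞} (hf : Measurable f) :
    ∫⁻ ω, {ω | FirstExceeds a (fun j ↦ B (s j) ω) k}.indicator (fun ω ↦ f (B t ω)) ω ∂P =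
      ∫⁻ ω, {ω | FirstExceeds a (fun j ↦ B (s j) ω) k}.indicator
        (fun ω ↦ f (2 * B (s k) ω - B t ω)) ω ∂P := by
  classical
  have hP : IsProbabilityMeasure P := hB.isGaussianProcess.isProbabilityMeasure
  obtain ⟨r, rfl⟩ := exists_add_of_le hk
  -- `ψ` exhibits the pair `V` as a measurable function of the path up to `s k`, hence independent
  -- of the later increment `Z`. The default `0` is never read, since `s` is monotone and only
  -- indices up to `k` matter.
  let ψ : (Set.Iic (s k) → ℝ) → ℝ × ℝ≥0∞ := fun v ↦
    (v ⟨s k, Set.mem_Iic.2 le_rfl⟩,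
      {v : Set.Iic (s k) → ℝ | FirstExceeds a
        (fun j ↦ if h : s j ≤ s k then v ⟨s j, h⟩ else 0) k}.indicator 1 v)
  have hψ : Measurable ψ := by
    refine (measurable_pi_apply _).prodMk (measurable_one.indicator
      (measurableSet_firstExceeds a fun j hj ↦ ?_))
    simp only [hs hj, dite_true]
    exact measurable_pi_apply _
  let Z : Ω → ℝ := fun ω ↦ B (s k + r) ω - B (s k) ω
  let V : Ω → ℝ × ℝ≥0∞ := fun ω ↦ (B (s k) ω,
      {ω | FirstExceeds a (fun j ↦ B (s j) ω) k}.indicator 1 ω)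
  have hVψ : V = ψ ∘ fun ω (u : Set.Iic (s k)) ↦ B u ω := by
    funext ω
    refine Prod.ext rfl ?_
    have hiff : FirstExceeds a (fun j ↦ B (s j) ω) k ↔ FirstExceeds a
        (fun j ↦ if h : s j ≤ s k then B (s j) ω else 0) k := by
      simp only [FirstExceeds, le_refl, dite_true]
      refine and_congr_right fun _ ↦ forall₂_congr fun j hj ↦ ?_
      simp [hs hj.le]
    simp [V, ψ, Set.indicator, hiff]
  have hind : IndepFun Z V P := by
    rw [hVψ]
    exact (hB.indepFun_shift (s k)).comp (measurable_pi_apply r) hψ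
  have hZlaw : HasLaw Z (gaussianReal 0 r) P := (hB.shift (s k)).hasLaw_eval r
  have hZ : AEMeasurable Z P := hZlaw.aemeasurable
  have hV : AEMeasurable V P := by
    refine (hB.aemeasurable _).prodMk ((aemeasurable_indicator_const_iff 1).2
      (hB.nullMeasurableSet_firstExceeds a s k))
  have hid : IdentDistrib (fun ω ↦ (Z ω, V ω)) (fun ω ↦ ((-Z) ω, V ω)) P P := by
    refine IdentDistrib.prodMk ?_ (IdentDistrib.refl hV) hind
      (hind.comp measurable_neg measurable_id)
    have h2 : HasLaw (-Z) (gaussianReal 0 r) P := by simpa using gaussianReal_neg hZlaw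
    exact ⟨hZ, h2.aemeasurable, hZlaw.map_eq.trans h2.map_eq.symm⟩
  have hg : Measurable fun p : ℝ × ℝ × ℝ≥0∞ ↦ p.2.2 * f (p.2.1 + p.1) := by fun_prop
  have h := (hid.comp hg).lintegral_eq
  simp only [Function.comp_def, V, Z, Pi.neg_apply] at h
  convert h using 3 with ω ω
  · by_cases hω : FirstExceeds a (fun j ↦ B (s j) ω) k <;> simp [Set.indicator, hω]
  · by_cases hω : FirstExceeds a (fun j ↦ B (s j) ω) k <;> simp [Set.indicator, hω]
    congr 1; ring

end Discrete

/-! ### Continuous paths along refined grids -/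

lemma NNReal.tendsto_mul_floor_div {t u : ℝ≥0} (ht : 0 < t) :
    Tendsto (fun m : ℕ ↦ t * ((⌊(u / t) * m⌋₊ : ℝ≥0) / m)) atTop (𝓝 u) := by
  have h : Tendsto (fun m : ℕ ↦ (⌊((u / t : ℝ≥0) : ℝ) * (m : ℝ)⌋₊ : ℝ) / (m : ℝ)) atTop
      (𝓝 ((u / t : ℝ≥0) : ℝ)) :=
    (tendsto_nat_floor_mul_div_atTop (u / t : ℝ≥0).coe_nonneg).comp tendsto_natCast_atTop_atTop
  have h' : Tendsto (fun m : ℕ ↦ ((⌊(u / t) * m⌋₊ : ℝ≥0) / m)) atTop (𝓝 (u / t)) := by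
    rw [← NNReal.tendsto_coe]
    convert h using 2 with m
    push_cast
    rfl
  have := h'.const_mul t
  rwa [mul_div_cancel₀ _ ht.ne'] at this

section Path

variable {c : ℝ≥0 → ℝ} {a : ℝ} {t : ℝ≥0}

lemma Continuous.eventually_exists_grid_gt (hc : Continuous c) (ht : 0 < t) {u : ℝ≥0} (hu : u ≤ t)
    (h : a < c u) : ∀ᶠ m : ℕ in atTop, ∃ j ≤ m, a < c (t * ((j : ℝ≥0) / m)) := by
  have h1 := (hc.tendsto u).comp (NNReal.tendsto_mul_floor_div (u := u) ht)
  filter_upwards [h1.eventually_const_lt h] with m hm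
  refine ⟨_, ?_, hm⟩
  refine Nat.floor_le_of_le ?_
  calc u / t * m ≤ 1 * m := by gcongr; exact div_le_one_of_le₀ hu zero_le
    _ = m := one_mul _

/-- The preceding grid value is at most `a`, so uniform continuity bounds the overshoot by `ε`. The
index `0` has no predecessor, but `c 0 ≤ a` excludes it. -/
lemma Continuous.eventually_grid_firstExceeds_near (hc : Continuous c) (h0 : c 0 ≤ a) {ε : ℝ}
    (hε : 0 < ε) : ∀ᶠ m : ℕ in atTop, ∀ k ≤ m,
      FirstExceeds a (fun j ↦ c (t * ((j : ℝ≥0) / m))) k → dist (c (t * ((k : ℝ≥0) / m))) a < ε := by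
  have huc := (isCompact_Icc (a := (0 : ℝ≥0)) (b := t)).uniformContinuousOn_of_continuous
    hc.continuousOn
  obtain ⟨δ, hδ, H⟩ := Metric.uniformContinuousOn_iff.1 huc ε hε
  have hlim : Tendsto (fun m : ℕ ↦ (t : ℝ) / m) atTop (𝓝 0) :=
    tendsto_const_div_atTop_nhds_zero_nat _
  filter_upwards [hlim.eventually_lt_const hδ, eventually_gt_atTop 0] with m hm hm0 k hkm hk
  obtain ⟨hk1, hk2⟩ := hk
  rcases k with _ | k
  · simp only [Nat.cast_zero, zero_div, mul_zero] at hk1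
    exact absurd hk1 (not_lt.2 h0)
  have hle := hk2 k (Nat.lt_succ_self k)
  have hmem : ∀ j ≤ m, t * ((j : ℝ≥0) / m) ∈ Set.Icc 0 t := fun j hj ↦ by
    refine ⟨zero_le, mul_le_of_le_one_right zero_le (div_le_one_of_le₀ ?_ zero_le)⟩
    exact_mod_cast hj
  have hd : dist (t * (((k + 1 : ℕ) : ℝ≥0) / m)) (t * ((k : ℝ≥0) / m)) < δ := by
    rw [NNReal.dist_eq]
    push_cast
    have hm' : (m : ℝ) ≠ 0 := by positivity
    have : (t : ℝ) * ((k + 1) / m) - t * (k / m) = t / m := by field_simp; ring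
    rw [this, abs_of_nonneg (by positivity)]
    exact hm
  have := H _ (hmem _ hkm) _ (hmem k (by omega)) hd
  rw [Real.dist_eq] at this ⊢
  simp only at hk1 hle
  rw [abs_of_nonneg (by linarith)] at this ⊢
  linarith

/-- The path `c` exceeds `a` at some point of some regular subdivision of `[0, t]`. -/
def ExceedsOnGrid (c : ℝ≥0 → ℝ) (a : ℝ) (t : ℝ≥0) : Prop :=
  ∃ m j : ℕ, j ≤ m ∧ a < c (t * ((j : ℝ≥0) / m))

/-- The grid form involves countably many times, which makes the event null measurable. The grid `m
= 0` only contributes the time `0`. -/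
lemma Continuous.exceedsOnGrid_iff (hc : Continuous c) (ht : 0 < t) :
    ExceedsOnGrid c a t ↔ ∃ u ≤ t, a < c u := by
  constructor
  · rintro ⟨m, j, hj, h⟩
    refine ⟨_, mul_le_of_le_one_right zero_le (div_le_one_of_le₀ ?_ zero_le), h⟩
    exact_mod_cast hj
  · rintro ⟨u, hu, h⟩
    obtain ⟨m, j, hj, h⟩ := (hc.eventually_exists_grid_gt ht hu h).exists
    exact ⟨m, j, hj, h⟩

open Classical in
lemma Continuous.tendsto_firstExceedsValue (hc : Continuous c) (ht : 0 < t) (h0 : c 0 ≤ a)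
    {g : ℝ → ℝ≥0∞} (hg : Continuous g) :
    Tendsto (fun m : ℕ ↦ firstExceedsValue a (fun j ↦ c (t * ((j : ℝ≥0) / m))) m
      (fun k ↦ g (c (t * ((k : ℝ≥0) / m))))) atTop
      (𝓝 (if ExceedsOnGrid c a t then g a else 0)) := by
  split_ifs with hE
  · obtain ⟨u, hu, hau⟩ := (hc.exceedsOnGrid_iff ht).1 hE
    intro U hU
    obtain ⟨ε, hε, hball⟩ := Metric.mem_nhds_iff.1 (hg.continuousAt hU)
    rw [mem_map]
    filter_upwards [hc.eventually_exists_grid_gt ht hu hau,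
      hc.eventually_grid_firstExceeds_near (t := t) h0 hε] with m h1 h2
    obtain ⟨k, hkm, hk⟩ := exists_firstExceeds (x := fun j : ℕ ↦ c (t * ((j : ℝ≥0) / m))) h1
    rw [Set.mem_preimage, hk.value_eq hkm]
    exact hball (h2 k hkm hk)
  · refine tendsto_const_nhds.congr fun m ↦ (firstExceedsValue_eq_zero (fun j hj ↦ ?_) _).symm
    exact not_lt.1 fun h ↦ hE ⟨m, j, hj, h⟩

end Path

/-! ### The reflection principle for Brownian motion -/

section Reflection

variable {Ω : Type*} [MeasurableSpace Ω] {P : Measure Ω} {B : ℝ≥0 → Ω → ℝ} {a : ℝ} {t : ℝ≥0}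

lemma ProbabilityTheory.IsPreBrownianReal.aemeasurable_indicator_firstExceeds
    (hB : IsPreBrownianReal B P) (a : ℝ) (s : ℕ → ℝ≥0) (k : ℕ) {g : Ω → ℝ≥0∞}
    (hg : AEMeasurable g P) :
    AEMeasurable ({ω | FirstExceeds a (fun j ↦ B (s j) ω) k}.indicator g) P :=
  hg.indicator₀ (hB.nullMeasurableSet_firstExceeds a s k)

lemma ProbabilityTheory.IsPreBrownianReal.lintegral_firstExceedsValue_reflect
    (hB : IsPreBrownianReal B P) (a : ℝ) (t : ℝ≥0) (m : ℕ) {f : ℝ → ℝ≥0∞} (hf : Measurable f) :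
    ∫⁻ ω, firstExceedsValue a (fun j ↦ B (t * ((j : ℝ≥0) / m)) ω) m (fun _ ↦ f (B t ω)) ∂P =
      ∫⁻ ω, firstExceedsValue a (fun j ↦ B (t * ((j : ℝ≥0) / m)) ω) m
        (fun k ↦ f (2 * B (t * ((k : ℝ≥0) / m)) ω - B t ω)) ∂P := by
  have hm {g : ℕ → Ω → ℝ≥0∞} (hg : ∀ k, AEMeasurable (g k) P) :
      ∫⁻ ω, firstExceedsValue a (fun j ↦ B (t * ((j : ℝ≥0) / m)) ω) m (fun k ↦ g k ω) ∂P =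
      ∑ k ∈ Finset.range (m + 1), ∫⁻ ω, {ω | FirstExceeds a
        (fun j ↦ B (t * ((j : ℝ≥0) / m)) ω) k}.indicator (g k) ω ∂P := by
    rw [← lintegral_finsetSum' _ fun k _ ↦
      hB.aemeasurable_indicator_firstExceeds a (fun j ↦ t * ((j : ℝ≥0) / m)) k (hg k)]
    rfl
  have hBt := hB.aemeasurable t
  rw [hm (g := fun _ ω ↦ f (B t ω)) fun _ ↦ hf.comp_aemeasurable hBt,
    hm (g := fun k ω ↦ f (2 * B (t * ((k : ℝ≥0) / m)) ω - B t ω)) fun k ↦ hf.comp_aemeasurable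
      (((hB.aemeasurable _).const_mul 2).sub hBt)]
  refine Finset.sum_congr rfl fun k hk ↦ ?_
  refine hB.lintegral_reflect_of_firstExceeds a (s := fun j ↦ t * ((j : ℝ≥0) / m)) ?_ ?_ hf
  · intro i j hij
    dsimp only
    gcongr
  · refine mul_le_of_le_one_right zero_le (div_le_one_of_le₀ ?_ zero_le)
    exact_mod_cast Nat.lt_succ_iff.1 (Finset.mem_range.1 hk)

lemma ProbabilityTheory.IsPreBrownianReal.nullMeasurableSet_exceedsOnGrid
    (hB : IsPreBrownianReal B P) (a : ℝ) (t : ℝ≥0) :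
    NullMeasurableSet {ω | ExceedsOnGrid (B · ω) a t} P := by
  have : {ω | ExceedsOnGrid (B · ω) a t} =
      ⋃ (m : ℕ) (j : ℕ) (_ : j ≤ m), {ω | a < B (t * ((j : ℝ≥0) / m)) ω} := by
    ext ω; simp [ExceedsOnGrid]
  rw [this]
  exact .iUnion fun m ↦ .iUnion fun j ↦ .iUnion fun _ ↦
    nullMeasurableSet_lt aemeasurable_const (hB.aemeasurable _)

-- Boundedness of `f` gives dominated convergence; its continuity lets the value at the first
-- exceedance be replaced by `a` in the limit. `key` is applied to both sides of the grid identity,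
-- with `f y` and with `f (2 * x - y)`.
open BoundedContinuousFunction in
lemma ProbabilityTheory.IsBrownianReal.lintegral_reflect (hB : IsBrownianReal B P) (ht : 0 < t)
    (ha : 0 ≤ a) (f : ℝ →ᵇ ℝ≥0) :
    ∫⁻ ω in {ω | ExceedsOnGrid (B · ω) a t}, f (B t ω) ∂P =
      ∫⁻ ω in {ω | ExceedsOnGrid (B · ω) a t}, f (2 * a - B t ω) ∂P := by
  have hP : IsProbabilityMeasure P := hB.isGaussianProcess.isProbabilityMeasure
  have hE := hB.nullMeasurableSet_exceedsOnGrid a t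
  have hBt := hB.aemeasurable
  have hfm : Measurable fun x ↦ (f x : ℝ≥0∞) := by fun_prop
  have hfC : ∀ x, (f x : ℝ≥0∞) ≤ (nndist f 0 : ℝ≥0) := fun x ↦ by
    exact_mod_cast BoundedContinuousFunction.NNReal.upper_bound f x
  have key {g : ℝ → ℝ → ℝ≥0∞} (hgc : ∀ y, Continuous fun x ↦ g x y)
      (hgm : Measurable (Function.uncurry g)) (hgC : ∀ x y, g x y ≤ (nndist f 0 : ℝ≥0)) :
      Tendsto (fun m : ℕ ↦ ∫⁻ ω, firstExceedsValue a (fun j ↦ B (t * ((j : ℝ≥0) / m)) ω) m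
        (fun k ↦ g (B (t * ((k : ℝ≥0) / m)) ω) (B t ω)) ∂P) atTop
        (𝓝 (∫⁻ ω in {ω | ExceedsOnGrid (B · ω) a t}, g a (B t ω) ∂P)) := by
    rw [← lintegral_indicator₀ hE]
    refine tendsto_lintegral_of_dominated_convergence' (fun _ ↦ (nndist f 0 : ℝ≥0))
      (fun m ↦ ?_) (fun m ↦ ae_of_all _ fun ω ↦ firstExceedsValue_le fun k ↦ hgC _ _)
      (by simp) ?_
    · refine Finset.aemeasurable_fun_sum _ fun k _ ↦ ?_
      exact hB.aemeasurable_indicator_firstExceeds a (fun j ↦ t * ((j : ℝ≥0) / m)) k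
        (g := fun ω ↦ g (B (t * ((k : ℝ≥0) / m)) ω) (B t ω))
        (hgm.comp_aemeasurable ((hBt _).prodMk (hBt t)))
    · filter_upwards [hB.cont, hB.eval_zero_ae_eq_zero] with ω h1 h2
      exact h1.tendsto_firstExceedsValue ht (h2.trans_le ha) (hgc (B t ω))
  refine tendsto_nhds_unique (key (g := fun _ y ↦ f y) (fun _ ↦ continuous_const)
    (by fun_prop) (fun _ _ ↦ hfC _)) ?_
  simp_rw [hB.lintegral_firstExceedsValue_reflect a t _ hfm]
  refine key (g := fun x y ↦ f (2 * x - y)) (fun y ↦ ?_) ?_ fun _ _ ↦ hfC _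
  · exact ENNReal.continuous_coe.comp (f.continuous.comp (by fun_prop))
  · exact hfm.comp (by fun_prop)

/-- **Reflection principle**: the law of `B t` on the event that the level `a` is exceeded before
time `t` is invariant under reflection at `a`. -/
lemma ProbabilityTheory.IsBrownianReal.measure_reflect (hB : IsBrownianReal B P) (ht : 0 < t)
    (ha : 0 ≤ a) {A : Set ℝ} (hA : MeasurableSet A) :
    P ({ω | ExceedsOnGrid (B · ω) a t} ∩ B t ⁻¹' A) =
      P ({ω | ExceedsOnGrid (B · ω) a t} ∩ (fun ω ↦ 2 * a - B t ω) ⁻¹' A) := by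
  have hP : IsProbabilityMeasure P := hB.isGaussianProcess.isProbabilityMeasure
  have hE := hB.nullMeasurableSet_exceedsOnGrid a t
  have h1 : AEMeasurable (B t) (P.restrict {ω | ExceedsOnGrid (B · ω) a t}) :=
    (hB.aemeasurable t).restrict
  have h2 : AEMeasurable (fun ω ↦ 2 * a - B t ω)
      (P.restrict {ω | ExceedsOnGrid (B · ω) a t}) := h1.const_sub _
  have h : (P.restrict {ω | ExceedsOnGrid (B · ω) a t}).map (B t) =
      (P.restrict {ω | ExceedsOnGrid (B · ω) a t}).map (fun ω ↦ 2 * a - B t ω) := by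
    refine ext_of_forall_lintegral_eq_of_IsFiniteMeasure fun f ↦ ?_
    rw [lintegral_map' (by fun_prop) h1, lintegral_map' (by fun_prop) h2]
    exact hB.lintegral_reflect ht ha f
  have := congrArg (fun μ ↦ μ A) h
  simp only [Measure.map_apply_of_aemeasurable h1 hA,
    Measure.map_apply_of_aemeasurable h2 hA] at this
  rwa [Measure.restrict_apply₀' hE, Measure.restrict_apply₀' hE, Set.inter_comm,
    Set.inter_comm _ {ω | ExceedsOnGrid (B · ω) a t}] at this

end Reflection

/-! ### From exceedance to the crossing time -/

lemma ExceedsOnGrid.of_lt {c : ℝ≥0 → ℝ} {a : ℝ} {t : ℝ≥0} (h : a < c t) : ExceedsOnGrid c a t :=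
  ⟨1, 1, le_rfl, by simpa using h⟩

lemma crossingTime_lt_iff {Ω : Type*} {S : ℝ≥0 → Ω → ℝ} {a : ℝ} {ω : Ω} {t : ℝ≥0} :
    crossingTime S a ω < t ↔ ∃ u < t, a ≤ S u ω := by
  simp [crossingTime, iInf_lt_iff, and_comm]

section CrossingTime

variable {Ω : Type*} [MeasurableSpace Ω] {P : Measure Ω} {B : ℝ≥0 → Ω → ℝ} {a : ℝ} {t : ℝ≥0}

lemma ProbabilityTheory.IsBrownianReal.measure_exceedsOnGrid_inter (hB : IsBrownianReal B P)
    (ht : 0 < t) (ha : 0 ≤ a) {A : Set ℝ} (hA : MeasurableSet A) (hAa : A ⊆ Set.Iio a) :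
    P ({ω | ExceedsOnGrid (B · ω) a t} ∩ B t ⁻¹' A) = P ((fun ω ↦ 2 * a - B t ω) ⁻¹' A) := by
  rw [hB.measure_reflect ht ha hA, Set.inter_eq_right.2]
  intro ω hω
  have : 2 * a - B t ω < a := hAa hω
  exact ExceedsOnGrid.of_lt (c := (B · ω)) (by linarith)

lemma ProbabilityTheory.IsBrownianReal.ae_eval_ne (hB : IsBrownianReal B P) (ht : 0 < t) (a : ℝ) :
    ∀ᵐ ω ∂P, B t ω ≠ a := by
  have hlaw := hB.hasLaw_eval t
  have : NullSingletonClass (gaussianReal 0 t) := nullSingletonClass_gaussianReal ht.ne'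
  have h : ∀ᵐ x ∂(P.map (B t)), x ≠ a := by
    rw [hlaw.map_eq]
    exact compl_mem_ae_iff.2 (measure_singleton a)
  exact ae_of_ae_map hlaw.aemeasurable h

/-- The running maximum of Brownian motion at time `t` exceeds `a ≥ 0` with twice the probability
that its value at time `t` does. -/
lemma ProbabilityTheory.IsBrownianReal.measure_exceedsOnGrid (hB : IsBrownianReal B P) (ht : 0 < t)
    (ha : 0 ≤ a) :
    P {ω | ExceedsOnGrid (B · ω) a t} = 2 * gaussianReal 0 t (Set.Ioi a) := by
  have hlaw := hB.hasLaw_eval t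
  have hlt : NullMeasurableSet (B t ⁻¹' Set.Iio a) P :=
    hlaw.aemeasurable.nullMeasurableSet_preimage measurableSet_Iio
  have hgt : P (B t ⁻¹' Set.Ioi a) = gaussianReal 0 t (Set.Ioi a) := by
    rw [← hlaw.map_eq, Measure.map_apply_of_aemeasurable hlaw.aemeasurable measurableSet_Ioi]
  rw [← measure_inter_add_sdiff₀ _ hlt, hB.measure_exceedsOnGrid_inter ht ha measurableSet_Iio
    subset_rfl, two_mul (gaussianReal _ _ _)]
  congr 1
  · rw [← hgt]
    congr 1
    ext ω
    simp only [Set.mem_preimage, Set.mem_Iio, Set.mem_Ioi]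
    constructor <;> intro h <;> linarith
  · rw [← hgt]
    refine measure_congr ?_
    filter_upwards [hB.ae_eval_ne ht a] with ω hω
    refine propext ⟨fun h ↦ lt_of_le_of_ne (not_lt.1 h.2) hω.symm, fun h ↦ ?_⟩
    have h' : a < B t ω := h
    exact ⟨ExceedsOnGrid.of_lt (c := (B · ω)) h', not_lt.2 h'.le⟩

lemma one_le_two_mul_gaussianReal_Ici_zero (v : ℝ≥0) : 1 ≤ 2 * gaussianReal 0 v (Set.Ici 0) := by
  have h : gaussianReal 0 v (Set.Iic 0) = gaussianReal 0 v (Set.Ici 0) := by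
    conv_lhs => rw [← neg_zero, ← gaussianReal_map_neg]
    rw [Measure.map_apply measurable_neg measurableSet_Iic]
    congr 1
    ext x
    simp
  rw [two_mul]
  nth_rewrite 1 [← h]
  rw [← measure_univ (μ := gaussianReal 0 v), ← Set.Iic_union_Ici (a := (0 : ℝ))]
  exact measure_union_le _ _

/-- For `a > 0`, a path that reaches `a` exceeds every level `b n` increasing to `a`, so the
running-maximum law passes to the limit. For `a = 0` no nonnegative lower levels exist, but the
bound is at least `1`. -/
lemma ProbabilityTheory.IsBrownianReal.measure_crossingTime_lt_le (hB : IsBrownianReal B P)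
    (ht : 0 < t) (ha : 0 ≤ a) :
    P {ω | crossingTime B a ω < t} ≤ 2 * gaussianReal 0 t (Set.Ici a) := by
  have hP : IsProbabilityMeasure P := hB.isGaussianProcess.isProbabilityMeasure
  rcases ha.eq_or_lt with rfl | ha
  · exact prob_le_one.trans (one_le_two_mul_gaussianReal_Ici_zero t)
  let b : ℕ → ℝ := fun n ↦ a - a / (n + 1)
  have hba : ∀ n, b n < a := fun n ↦ sub_lt_self _ (by positivity)
  have hb0 : ∀ n, 0 ≤ b n := fun n ↦ sub_nonneg.2 (div_le_self ha.le (by simp))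
  have hbm : Monotone b := fun m n hmn ↦ by
    dsimp only [b]
    gcongr
  have hlim : Tendsto b atTop (𝓝 a) := by
    have h : Tendsto (fun n : ℕ ↦ a / ((n : ℝ) + 1)) atTop (𝓝 0) := by
      simpa [div_eq_mul_inv] using (tendsto_one_div_add_atTop_nhds_zero_nat (𝕜 := ℝ)).const_mul a
    simpa [b] using h.const_sub a
  have hInter : ⋂ n, Set.Ioi (b n) = Set.Ici a := by
    ext x
    simp only [Set.mem_iInter, Set.mem_Ioi, Set.mem_Ici]
    exact ⟨fun h ↦ le_of_tendsto' hlim fun n ↦ (h n).le, fun h n ↦ (hba n).trans_le h⟩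
  have hT : Tendsto (fun n ↦ gaussianReal 0 t (Set.Ioi (b n))) atTop
      (𝓝 (gaussianReal 0 t (Set.Ici a))) := by
    rw [← hInter]
    exact tendsto_measure_iInter_atTop (fun n ↦ measurableSet_Ioi.nullMeasurableSet)
      (fun m n hmn ↦ Set.Ioi_subset_Ioi (hbm hmn)) ⟨0, measure_ne_top _ _⟩
  refine ge_of_tendsto' (ENNReal.Tendsto.const_mul hT (Or.inr (by simp))) fun n ↦ ?_
  rw [← hB.measure_exceedsOnGrid ht (hb0 n)]
  refine measure_mono_ae ?_
  filter_upwards [hB.cont] with ω hc h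
  obtain ⟨u, hut, hu⟩ := crossingTime_lt_iff.1 h
  exact (hc.exceedsOnGrid_iff ht).2 ⟨u, hut.le, (hba n).trans_le hu⟩

/-- Strict exceedance almost surely implies crossing, and the preceding bound shows that the
crossing event has no larger probability. Touching a level without exceeding it is thus null. -/
lemma ProbabilityTheory.IsBrownianReal.setOf_exceedsOnGrid_ae_eq (hB : IsBrownianReal B P)
    (ht : 0 < t) (ha : 0 ≤ a) :
    ({ω | ExceedsOnGrid (B · ω) a t} : Set Ω) =ᵐ[P] {ω | crossingTime B a ω < t} := by
  have hP : IsProbabilityMeasure P := hB.isGaussianProcess.isProbabilityMeasure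
  refine ae_eq_of_ae_subset_of_measure_ge ?_ ?_ (hB.nullMeasurableSet_exceedsOnGrid a t)
    (measure_ne_top _ _)
  · filter_upwards [hB.cont] with ω hc h
    obtain ⟨u, hut, hu⟩ := (hc.exceedsOnGrid_iff ht).1 h
    refine crossingTime_lt_iff.2 ?_
    rcases hut.lt_or_eq with hut | rfl
    · exact ⟨u, hut, hu.le⟩
    -- If the level is exceeded at the final time itself, left continuity supplies a strictly
    -- earlier time.
    · have hev : ∀ᶠ v in 𝓝[<] u, a < B v ω :=
        (hc.tendsto u).mono_left nhdsWithin_le_nhds |>.eventually_const_lt hu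
      have : (𝓝[<] u).NeBot := nhdsLT_neBot_of_exists_lt ⟨0, ht⟩
      obtain ⟨v, hv, hvu⟩ := (hev.and self_mem_nhdsWithin).exists
      exact ⟨v, hvu, hv.le⟩
  · have : NullSingletonClass (gaussianReal 0 t) := nullSingletonClass_gaussianReal ht.ne'
    rw [hB.measure_exceedsOnGrid ht ha, measure_congr Ioi_ae_eq_Ici]
    exact hB.measure_crossingTime_lt_le ht ha

lemma ProbabilityTheory.IsBrownianReal.nullMeasurableSet_crossingTime_lt (hB : IsBrownianReal B P)
    (ha : 0 ≤ a) (t : ℝ≥0) : NullMeasurableSet {ω | crossingTime B a ω < t} P := by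
  rcases eq_zero_or_pos t with rfl | ht
  · simp
  · exact (hB.nullMeasurableSet_exceedsOnGrid a t).congr (hB.setOf_exceedsOnGrid_ae_eq ht ha)

lemma ProbabilityTheory.IsBrownianReal.aemeasurable_crossingTime (hB : IsBrownianReal B P)
    (ha : 0 ≤ a) : AEMeasurable (crossingTime B a) P := by
  refine NullMeasurable.aemeasurable ?_
  refine measurable_of_Iio (δ := NullMeasurableSpace Ω P) fun x ↦ ?_
  change NullMeasurableSet {ω | crossingTime B a ω < x} P
  induction x with
  | coe t => exact hB.nullMeasurableSet_crossingTime_lt ha t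
  | top =>
    have : {ω | crossingTime B a ω < ∞} = ⋃ n : ℕ, {ω | crossingTime B a ω < (n : ℝ≥0)} := by
      ext ω
      rw [Set.mem_iUnion]
      refine ⟨fun h ↦ ?_, fun ⟨n, hn⟩ ↦
        show crossingTime B a ω < ∞ from
          lt_of_lt_of_le (show crossingTime B a ω < (n : ℝ≥0) from hn) le_top⟩
      obtain ⟨n, hn⟩ := ENNReal.exists_nat_gt (ne_of_lt h)
      exact ⟨n, by simpa using hn⟩
    rw [this]
    exact .iUnion fun n ↦ hB.nullMeasurableSet_crossingTime_lt ha n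

lemma ProbabilityTheory.IsBrownianReal.measure_crossingTime_lt_inter (hB : IsBrownianReal B P)
    (ht : 0 < t) (ha : 0 ≤ a) {A : Set ℝ} (hA : MeasurableSet A) (hAa : A ⊆ Set.Iio a) :
    P ({ω | crossingTime B a ω < t} ∩ B t ⁻¹' A) = P ((fun ω ↦ 2 * a - B t ω) ⁻¹' A) := by
  rw [← hB.measure_exceedsOnGrid_inter ht ha hA hAa]
  exact measure_congr ((hB.setOf_exceedsOnGrid_ae_eq ht ha).symm.inter (ae_eq_refl _))

end CrossingTime

/-! ### Gaussian density ratio and scaling -/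

/-- The exponent comes from (x - 2a)² = x² + 4a(a - x). -/
lemma gaussianPDFReal_two_mul (a : ℝ) {v : ℝ≥0} (hv : v ≠ 0) (x : ℝ) :
    gaussianPDFReal (2 * a) v x =
      gaussianPDFReal 0 v x * Real.exp (-(2 * a * (a - x) / v)) := by
  simp only [gaussianPDFReal, mul_assoc, ← Real.exp_add]
  congr 3
  have : (v : ℝ) ≠ 0 := by exact_mod_cast hv
  field_simp
  ring

lemma gaussianReal_two_mul (a : ℝ) {v : ℝ≥0} (hv : v ≠ 0) :
    gaussianReal (2 * a) v = (gaussianReal 0 v).withDensity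
      fun x ↦ ENNReal.ofReal (Real.exp (-(2 * a * (a - x) / v))) := by
  rw [gaussianReal_of_var_ne_zero _ hv, gaussianReal_of_var_ne_zero _ hv,
    ← withDensity_mul _ (measurable_gaussianPDF _ _) (by fun_prop)]
  congr 1
  ext x
  rw [Pi.mul_apply, gaussianPDF, gaussianPDF, gaussianPDFReal_two_mul a hv,
    ENNReal.ofReal_mul (gaussianPDFReal_nonneg _ _ _)]

lemma crossingTime_div {Ω : Type*} {σ : ℝ} (hσ : 0 < σ) (S : ℝ≥0 → Ω → ℝ) (τ : ℝ) :
    crossingTime (fun u ω ↦ S u ω / σ) (τ / σ) = crossingTime S τ := by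
  ext ω
  simp [crossingTime, div_le_div_iff_of_pos_right hσ]

/-! ### General variance and conditioning on the endpoint -/

section IsBrownianMotion

variable {Ω : Type*} [MeasurableSpace Ω] {P : Measure Ω} {S : ℝ≥0 → Ω → ℝ} {τ : ℝ} {t : ℝ≥0}

lemma IsBrownianMotion.aemeasurable_crossingTime (hS : IsBrownianMotion S P) (hτ : 0 ≤ τ) :
    AEMeasurable (crossingTime S τ) P := by
  obtain ⟨σ, hσ, hB⟩ := hS
  rw [← crossingTime_div hσ]
  exact hB.aemeasurable_crossingTime (div_nonneg hτ hσ.le)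

lemma IsBrownianMotion.exists_hasLaw (hS : IsBrownianMotion S P) (ht : 0 < t) :
    ∃ v : ℝ≥0, v ≠ 0 ∧ HasLaw (S t) (gaussianReal 0 v) P := by
  obtain ⟨σ, hσ, hB⟩ := hS
  refine ⟨NNReal.mk (σ ^ 2) (sq_nonneg σ) * t, mul_ne_zero ?_ ht.ne', ?_⟩
  · exact fun h ↦ (pow_pos hσ 2).ne' (congrArg NNReal.toReal h)
  · have h := gaussianReal_const_mul (hB.hasLaw_eval t) σ
    rw [mul_zero] at h
    convert h using 2 with ω
    field_simp

lemma IsBrownianMotion.measure_crossingTime_lt_inter (hS : IsBrownianMotion S P) (ht : 0 < t)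
    (hτ : 0 ≤ τ) {A : Set ℝ} (hA : MeasurableSet A) (hAτ : A ⊆ Set.Iio τ) :
    P ({ω | crossingTime S τ ω < t} ∩ S t ⁻¹' A) = P ((fun ω ↦ 2 * τ - S t ω) ⁻¹' A) := by
  obtain ⟨σ, hσ, hB⟩ := hS
  have h := hB.measure_crossingTime_lt_inter ht (div_nonneg hτ hσ.le)
    (A := (fun x ↦ σ * x) ⁻¹' A) (measurable_const_mul σ hA) fun x hx ↦ by
      rw [Set.mem_Iio, lt_div_iff₀ hσ, mul_comm]
      exact hAτ hx
  rw [crossingTime_div hσ] at h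
  have h1 : (fun x ↦ σ * x) ∘ (fun ω ↦ S t ω / σ) = S t := by
    ext ω
    exact mul_div_cancel₀ _ hσ.ne'
  have h2 : (fun x ↦ σ * x) ∘ (fun ω ↦ 2 * (τ / σ) - S t ω / σ) = fun ω ↦ 2 * τ - S t ω := by
    ext ω
    simp only [Function.comp]
    field_simp
  rwa [← Set.preimage_comp, ← Set.preimage_comp, h1, h2] at h

/-- The joint law of the event of crossing the level `τ` before time `t` and of the position at
time `t`, below the level. -/
lemma IsBrownianMotion.measure_crossingTime_lt_inter_eq_setLIntegral (hS : IsBrownianMotion S P)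
    (ht : 0 < t) (hτ : 0 ≤ τ) {A : Set ℝ} (hA : MeasurableSet A) (hAτ : A ⊆ Set.Iio τ) :
    P ({ω | crossingTime S τ ω < t} ∩ S t ⁻¹' A) =
      ∫⁻ x in A, ENNReal.ofReal (Real.exp (-(2 * τ * (τ - x) / variance (S t) P)))
        ∂(P.map (S t)) := by
  obtain ⟨v, hv, hlaw⟩ := hS.exists_hasLaw ht
  have h := gaussianReal_const_sub hlaw (2 * τ)
  rw [sub_zero] at h
  rw [hS.measure_crossingTime_lt_inter ht hτ hA hAτ,
    ← Measure.map_apply_of_aemeasurable h.aemeasurable hA, h.map_eq, hlaw.map_eq,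
    hlaw.variance_eq, variance_id_gaussianReal, gaussianReal_two_mul τ hv, withDensity_apply _ hA]

lemma IsBrownianMotion.tendsto_cond_crossingTime_lt (hS : IsBrownianMotion S P)
    (ht : 0 < t) (hτ : 0 ≤ τ) {θ : ℝ} (hθ : θ < τ) :
    Tendsto
      (fun h : ℝ ↦ ProbabilityTheory.cond P {ω | S t ω ∈ Set.Ico θ (θ + h)}
        {ω | crossingTime S τ ω < (t : ℝ≥0∞)})
      (𝓝[>] (0 : ℝ))
      (𝓝 (ENNReal.ofReal (Real.exp (-(2 * τ * (τ - θ) / variance (S t) P))))) := by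
  obtain ⟨v, hv, hlaw⟩ := hS.exists_hasLaw ht
  have hP : IsProbabilityMeasure P := hlaw.isProbabilityMeasure
  set e : ℝ → ℝ≥0∞ := fun x ↦ ENNReal.ofReal (Real.exp (-(2 * τ * (τ - x) / variance (S t) P)))
    with he
  have hcont : Continuous e := ENNReal.continuous_ofReal.comp (by fun_prop)
  have hmono : Monotone e := fun x y hxy ↦ by
    have := variance_nonneg (S t) P
    simp only [e]
    gcongr
  have hlim : Tendsto (fun h ↦ e (θ + h)) (𝓝[>] 0) (𝓝 (e θ)) := by
    have : Tendsto (fun h ↦ e (θ + h)) (𝓝 0) (𝓝 (e (θ + 0))) :=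
      (hcont.comp (continuous_const_add θ)).tendsto 0
    rw [add_zero] at this
    exact this.mono_left nhdsWithin_le_nhds
  have hev : ∀ᶠ h in 𝓝[>] (0 : ℝ), h ∈ Set.Ioo 0 (τ - θ) :=
    Ioo_mem_nhdsGT (sub_pos.2 hθ)
  have hmain : ∀ h ∈ Set.Ioo 0 (τ - θ), ∃ p : ℝ≥0∞, p ≠ 0 ∧ p ≠ ∞ ∧
      ProbabilityTheory.cond P {ω | S t ω ∈ Set.Ico θ (θ + h)}
        {ω | crossingTime S τ ω < (t : ℝ≥0∞)} = p⁻¹ * ∫⁻ x in Set.Ico θ (θ + h), e x ∂(P.map (S t))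
      ∧ P.map (S t) (Set.Ico θ (θ + h)) = p := by
    rintro h ⟨h0, h1⟩
    refine ⟨_, ?_, measure_ne_top _ _, ?_, rfl⟩
    · rw [hlaw.map_eq]
      intro hz
      have := gaussianReal_absolutelyContinuous' 0 hv hz
      rw [Real.volume_Ico, add_sub_cancel_left, ENNReal.ofReal_eq_zero] at this
      linarith
    · rw [← hS.measure_crossingTime_lt_inter_eq_setLIntegral ht hτ measurableSet_Ico
        (Set.Ico_subset_Iio_self.trans (Set.Iio_subset_Iio (by linarith))),
        Measure.map_apply_of_aemeasurable hlaw.aemeasurable measurableSet_Ico,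
        ProbabilityTheory.cond, Measure.smul_apply, smul_eq_mul]
      congr 1
      exact Measure.restrict_apply₀'
        (hlaw.aemeasurable.nullMeasurableSet_preimage measurableSet_Ico)
  -- The conditional probability is the mean of the increasing function `e` over [θ, θ + h), so it
  -- lies between `e θ` and `e (θ + h)`.
  refine tendsto_of_tendsto_of_tendsto_of_le_of_le' tendsto_const_nhds hlim ?_ ?_
  · filter_upwards [hev] with h hh
    obtain ⟨p, hp0, hpt, heq, hp⟩ := hmain h hh
    rw [heq, ← ENNReal.mul_le_mul_iff_right hp0 hpt, ← mul_assoc, ENNReal.mul_inv_cancel hp0 hpt,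
      one_mul, mul_comm, ← hp, ← setLIntegral_const]
    exact setLIntegral_mono hcont.measurable fun x hx ↦ hmono hx.1
  · filter_upwards [hev] with h hh
    obtain ⟨p, hp0, hpt, heq, hp⟩ := hmain h hh
    rw [heq, ← ENNReal.mul_le_mul_iff_right hp0 hpt, ← mul_assoc, ENNReal.mul_inv_cancel hp0 hpt,
      one_mul, mul_comm, ← hp, ← setLIntegral_const]
    exact setLIntegral_mono measurable_const fun x hx ↦ hmono hx.2.le

lemma IsBrownianMotion.condDistrib_crossingTime_lt [IsProbabilityMeasure P]
    (hS : IsBrownianMotion S P) (ht : 0 < t) (hτ : 0 ≤ τ) :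
    ∀ᵐ θ ∂(volume : Measure ℝ), θ < τ →
      condDistrib (crossingTime S τ) (S t) P θ (Set.Iio (t : ℝ≥0∞)) =
        ENNReal.ofReal (Real.exp (-(2 * τ * (τ - θ) / variance (S t) P))) := by
  obtain ⟨v, hv, hlaw⟩ := hS.exists_hasLaw ht
  have hac : (volume : Measure ℝ) ≪ P.map (S t) := by
    rw [hlaw.map_eq]
    exact gaussianReal_absolutelyContinuous' 0 hv
  -- The disintegration determines the kernel only up to null sets of the law of `S t`; these are
  -- Lebesgue null because the Gaussian is nondegenerate.
  refine hac.ae_le ?_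
  have hT := hS.aemeasurable_crossingTime hτ
  have hXm := hlaw.aemeasurable
  have hprob : IsProbabilityMeasure (P.map (S t)) := Measure.isProbabilityMeasure_map hXm
  refine (ae_restrict_iff' (s := Set.Iio τ) measurableSet_Iio).1 ?_
  -- Both functions have the same integrals over measurable subsets of `Set.Iio τ`: each equals the
  -- joint probability of crossing and ending there.
  refine ae_eq_of_forall_setLIntegral_eq_of_sigmaFinite
    (Kernel.measurable_coe _ measurableSet_Iio) (by fun_prop) fun A hA _ ↦ ?_
  rw [Measure.restrict_restrict hA, ← hS.measure_crossingTime_lt_inter_eq_setLIntegral ht hτ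
    (hA.inter measurableSet_Iio) Set.inter_subset_right,
    ← Measure.compProd_apply_prod (hA.inter measurableSet_Iio) measurableSet_Iio,
    compProd_map_condDistrib hT, Measure.map_apply_of_aemeasurable (hXm.prodMk hT)
      ((hA.inter measurableSet_Iio).prod measurableSet_Iio)]
  refine congrArg P (Set.ext fun ω ↦ ?_)
  exact and_comm

end IsBrownianMotion

theorem mainTheorem2 {Ω : Type*} [MeasurableSpace Ω] (P : Measure Ω) [IsProbabilityMeasure P]
    (S : ℝ≥0 → Ω → ℝ) (hS : IsBrownianMotion S P) (t : ℝ≥0) (ht : 0 < t) (τ : ℝ) (hτ : 0 ≤ τ) :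
    (∀ θ : ℝ, θ < τ →
      Tendsto
        (fun h : ℝ ↦ ProbabilityTheory.cond P {ω | S t ω ∈ Set.Ico θ (θ + h)}
          {ω | crossingTime S τ ω < (t : ℝ≥0∞)})
        (𝓝[>] (0 : ℝ))
        (𝓝 (ENNReal.ofReal (Real.exp (-(2 * τ * (τ - θ) / variance (S t) P)))))) ∧
    (∀ᵐ θ ∂(volume : Measure ℝ), θ < τ →
      condDistrib (crossingTime S τ) (S t) P θ (Set.Iio (t : ℝ≥0∞)) =
        ENNReal.ofReal (Real.exp (-(2 * τ * (τ - θ) / variance (S t) P)))) :=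
  ⟨fun _ hθ ↦ hS.tendsto_cond_crossingTime_lt ht hτ hθ, hS.condDistrib_crossingTime_lt ht hτ⟩
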